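/- **Setting.** Consider a standard irregular LDPC ensemble in which a fraction $\lambda_i$ of the edges is attached to variable nodes of degree $i$ (finitely many $\lambda_i\neq 0$, $\sum_i\lambda_i=1$), all variable node degrees are at least five ($\lambda_i=0$ for $i<5$), and all check nodes have the same degree $d_r+1$ with $d_r\ge 1$. Let $\mathsf c$ be the $L$-distribution of a binary memoryless symmetric channel: a probability measure on $\mathbb R$ that is symmetric, i.e. $\int f(x)\,d\mathsf c(x)=\int e^{-x}f(-x)\,d\mathsf c(x)$ for all bounded continuous $f$. Assume that $\mathsf c$ is supported on a bounded interval $(-L,L)$. For a probability measure $\mathsf a$ on $\mathbb R$ and $y\sim\mathsf a$ let $\mathfrak B(\mathsf a)=\mathbb E[e^{-y/2}]$ and $P_e(\mathsf a)=\mathbb P\{y<0\}+\tfrac12\mathbb P\{y=0\}$. Let $\rho(\mathsf a)$ be the law of $2\tanh^{-1}\bigl(\prod_{i=1}^{d_r}\tanh(\mu_i/2)\bigr)$ with $\mu_1,\dots,\mu_{d_r}$ i.i.d. of law $\mathsf a$. One step of BP density evolution is $T(\mathsf a)=\sum_i\lambda_i\,\mathsf c\circledast\rho(\mathsf a)^{\circledast(i-1)}$,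 where $\circledast$ is convolution, and one step of density evolution of the saturated decoder (SatBP) is $S_K(\mathsf a)=\lfloor T(\mathsf a)\rfloor_K$, the law of $\min(K,|x|)\,\mathrm{sgn}(x)$ for $x\sim T(\mathsf a)$. Call BP successful on $\mathsf c$ if for every $\varepsilon>0$ there is $\ell$ with $\mathfrak B(T^{\ell}(\Delta_0))<\varepsilon$. A probability measure on $[-K,K]$ is written $\mathsf a=\gamma D(p,K)+\bar\gamma\,\mathsf m$ with $\bar\gamma=1-\gamma$, where $D(p,z)=p\Delta_{-z}+(1-p)\Delta_{z}$ and $\mathsf m$ is a probability measure on $(-K,K)$. Put $$E_K(\mathsf a)=\bar\gamma\,\mathfrak B(\mathsf m)+e^{K/2}\gamma p,\qquad \xi_K(\mathsf a)=(d_r-1)\,\gamma\, e^{K/2}\,\mathfrak B(D(p,K))+1 .$$ **Theorem.** There is $x^*>0$ such that the following hold. 1. There is $K_0>0$ such that for every $K\ge K_0$ there are $N\in\mathbb N$ and $q\in(0,1)$ with the following property. Let $\mathsf a^{(0)}$ be any probability measure on $[-K,K]$, not necessarily symmetric, with $\mathfrak B(\mathsf a^{(0)})\le x^*$, and let $\mathsf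 a^{(n)}=S_K^{n}(\mathsf a^{(0)})$. Then for all $n\ge N$ $$E_K(\mathsf a^{(n+1)})\le 2\,\bigl(d_r\,\xi_K(\mathsf a^{(n)})\bigr)^2E_K(\mathsf a^{(n)})^2,\qquad \xi_K(\mathsf a^{(n)})\le 3d_r ,$$ and the bit error probability converges to zero doubly exponentially: for all $k\ge0$ $$P_e(\mathsf a^{(N+k)})\le E_K(\mathsf a^{(N+k)})\le q^{2^k}.$$ 2. If BP is successful on $\mathsf c$, then there is $K_1>0$ such that for every $K\ge K_1$ one has $\mathfrak B(S_K^{n_0}(\Delta_0))\le x^*$ for some $n_0$, and there are $N\in\mathbb N$ and $q\in(0,1)$ with $P_e(S_K^{N+k}(\Delta_0))\le q^{2^k}$ for all $k\ge 0$. -/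

import Mathlib

open MeasureTheory Set Filter
open scoped NNReal ENNReal BoundedContinuousFunction

namespace SatBP

noncomputable section

/-- An `L`-distribution `a` on `ℝ` is symmetric if `∫ f(x) da(x) = ∫ e^{-x} f(-x) da(x)`
for every bounded continuous `f`. -/
def IsSymmetric (a : Measure ℝ) : Prop :=
  ∀ f : ℝ →ᵇ ℝ, ∫ x, f x ∂a = ∫ x, Real.exp (-x) * f (-x) ∂a

/-- Bhattacharyya parameter `𝔅(a) = 𝔼[e^{-y/2}]`, `y ∼ a`. -/
def batta (a : Measure ℝ) : ℝ := ∫ x, Real.exp (-x / 2) ∂a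

/-- Error probability `ℙ{y < 0} + ½ ℙ{y = 0}`, `y ∼ a`. -/
def perr (a : Measure ℝ) : ℝ := a.real (Iio 0) + 1 / 2 * a.real {0}

/-- The sign function with `sgn 0 = 1`. -/
def sgn (x : ℝ) : ℝ := if x < 0 then -1 else 1

/-- Saturation at `±K`. -/
def sat (K x : ℝ) : ℝ := min K |x| * sgn x

/-- The belief propagation update at a check node with `d` incoming messages. -/
def checkUpdate (d : ℕ) (μ : Fin d → ℝ) : ℝ :=
  2 * Real.artanh (∏ i, Real.tanh (μ i / 2))

/-- The belief propagation update at a variable node: channel value `z.1`, and `d` incoming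
messages `z.2`. -/
def varUpdate (d : ℕ) (z : ℝ × (Fin d → ℝ)) : ℝ := z.1 + ∑ i, z.2 i

theorem measurable_sat (K : ℝ) : Measurable (sat K) := by
  unfold sat sgn
  exact (measurable_const.min measurable_id.abs).mul
    (Measurable.ite measurableSet_Iio measurable_const measurable_const)

theorem measurable_checkUpdate (d : ℕ) : Measurable (checkUpdate d) := by
  have h : Measurable Real.tanh := by
    have : Real.tanh = fun x => Real.sinh x / Real.cosh x := by
      funext x; exact Real.tanh_eq_sinh_div_cosh x
    rw [this]; fun_prop
  have h' : Measurable Real.artanh := by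
    unfold Real.artanh; fun_prop
  unfold checkUpdate
  refine (h'.comp (Finset.measurable_prod _ fun i _ => h.comp ?_)).const_mul 2
  fun_prop

theorem measurable_varUpdate (d : ℕ) : Measurable (varUpdate d) := by
  unfold varUpdate; fun_prop

/-- `a^{⊠ d}`: the law of the outgoing message of a check node with `d` independent incoming
messages of law `a`. -/
def checkConv (d : ℕ) (a : Measure ℝ) : Measure ℝ :=
  (Measure.pi fun _ : Fin d => a).map (checkUpdate d)

/-- `c ⊛ b^{⊛ d}`: the law of the outgoing (unsaturated) message of a variable node with
channel law `c` and `d` independent incoming messages of law `b`. -/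
def varConv (c : Measure ℝ) (d : ℕ) (b : Measure ℝ) : Measure ℝ :=
  (c.prod (Measure.pi fun _ : Fin d => b)).map (varUpdate d)

/-- One step `T(c, a) = c ⊛ λ(ρ(a))` of density evolution of the full BP decoder. Here `lam i`
is the fraction of edges attached to variable nodes of degree `i`, and all check nodes have
degree `dr + 1`. -/
def bpStep (lam : ℕ →₀ ℝ≥0) (dr : ℕ) (c a : Measure ℝ) : Measure ℝ :=
  ∑ i ∈ lam.support, lam i • varConv c (i - 1) (checkConv dr a)

/-- One step `S_K(c, a) = ⌊T(c, a)⌋_K` of density evolution of the saturated BP decoder. -/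
def satStep (lam : ℕ →₀ ℝ≥0) (dr : ℕ) (c : Measure ℝ) (K : ℝ) (a : Measure ℝ) : Measure ℝ :=
  (bpStep lam dr c a).map (sat K)

/-- The `n`-th density `S_K^{(n)}(c, a)` of saturated density evolution started at `a`. -/
def satDE (lam : ℕ →₀ ℝ≥0) (dr : ℕ) (c : Measure ℝ) (K : ℝ) (a : Measure ℝ) (n : ℕ) :
    Measure ℝ :=
  (satStep lam dr c K)^[n] a

/-- The full BP decoder is successful on `c`: along density evolution started at `Δ_0`, for
every `ε > 0` the Bhattacharyya parameter is below `ε` at some iteration. -/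
def BPSuccessful (lam : ℕ →₀ ℝ≥0) (dr : ℕ) (c : Measure ℝ) : Prop :=
  ∀ ε : ℝ, 0 < ε → ∃ l : ℕ, batta ((bpStep lam dr c)^[l] (Measure.dirac 0)) < ε

/-! The decomposition `a = γ D(p, K) + (1 - γ) m` of a probability measure `a` on `[-K, K]`. -/

/-- `D(p, z) = p Δ_{-z} + (1 - p) Δ_z`. -/
def twoPoint (p z : ℝ) : Measure ℝ :=
  ENNReal.ofReal p • Measure.dirac (-z) + ENNReal.ofReal (1 - p) • Measure.dirac z

/-- The saturated mass `γ`. -/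
def satMass (K : ℝ) (a : Measure ℝ) : ℝ := a.real {x | |x| = K}

/-- The conditional probability `p` of the value `-K` given saturation (`0` if `γ = 0`). -/
def satErr (K : ℝ) (a : Measure ℝ) : ℝ := a.real {-K} / satMass K a

/-- The normalized unsaturated part `m`, supported on `(-K, K)` (zero if `γ = 1`). -/
def unsat (K : ℝ) (a : Measure ℝ) : Measure ℝ := ProbabilityTheory.cond a (Ioo (-K) K)

/-- The tracked quantity `(1 - γ) 𝔅(m) + e^{K/2} γ p`. -/
def tracked (K : ℝ) (a : Measure ℝ) : ℝ :=
  (1 - satMass K a) * batta (unsat K a) + Real.exp (K / 2) * (satMass K a * satErr K a)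

/-- The check node factor `ξ = (dr - 1) γ e^{K/2} 𝔅(D(p, K)) + 1`. -/
def xi (dr : ℕ) (K : ℝ) (a : Measure ℝ) : ℝ :=
  ((dr : ℝ) - 1) * satMass K a * Real.exp (K / 2) * batta (twoPoint (satErr K a) K) + 1

end

end SatBP

namespace SatBP

/-! ### Pointwise bounds for the check node update -/

/-! The Bhattacharyya parameter of a saturated density cannot tend to zero: the mass at `+K` alone
contributes about `e^{-K/2}`. The cure is to drop that correct mass and follow `E_K(a) = ∫ e^{-x/2}
1_{x<K} da`, which still dominates the error probability. All node estimates hold realization by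
realization and are then integrated over independent messages, so the starting density need not be
symmetric. Symmetry of the channel enters only through `𝔅(c) ≤ 1`.

The elementary inequality at a check node is `e^{-out} ≤ ∑ e^{-μ_i}`, which passes to half
exponents. In the first phase it gives `𝔅' ≤ (dr 𝔅)^4 + e^{-K/2}` (`lintegral_bw_satStep_le`), the
fourth power coming from the minimal degree five. Below `x* = 1/(2 dr²)` this is a contraction up to
the saturation floor, so `𝔅 ≤ 2e^{-K/2}` after a number of steps independent of the start. This
forces `e^K a{-K} ≤ 2`, hence `ξ ≤ 3 dr` (`xi_le`).

In the second phase, a check output below `θ = K - log dr` needs an input below `K`, which makes the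
truncated quantity grow by a factor at most `dr ξ` (`lintegral_tw_checkConv_le`). At a variable node
at least four messages arrive. If at most one is below `θ`, the sum is at least `3θ - K - L ≥ K`; so
an output below `K` needs two bad inputs, and `E_K` gets squared (`lintegral_tw_varConv_le`). The
combinatorial factor is absorbed by the remaining messages. The result is `E' ≤ (dr ξ E)² ≤ 9 dr^4
E²`, with `9 dr^4 E ≤ 1/2` initially once `K` is large.

For successful BP, only finitely many steps are needed to get below `x*`. The densities up to that
time have bounded support, so for large `K` saturation has not yet acted and the local statement
takes over. -/

theorem tanh_le_tanh {x y : ℝ} (h : x ≤ y) : Real.tanh x ≤ Real.tanh y := by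
  rw [← Real.artanh_le_artanh_iff ⟨Real.neg_one_lt_tanh x, Real.tanh_lt_one x⟩
    ⟨Real.neg_one_lt_tanh y, Real.tanh_lt_one y⟩]
  simpa [Real.artanh_tanh] using h

theorem one_sub_tanh_div (x : ℝ) :
    (1 - Real.tanh (x / 2)) / (1 + Real.tanh (x / 2)) = Real.exp (-x) := by
  have h : Real.exp (-x) = Real.exp (-(x / 2)) / Real.exp (x / 2) := by
    rw [← Real.exp_sub]; congr 1; ring
  rw [h, Real.tanh_eq_sinh_div_cosh, Real.sinh_eq, Real.cosh_eq]
  have h1 := Real.exp_pos (x / 2)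
  have h2 := Real.exp_pos (-(x / 2))
  field_simp
  ring

/-- With `u = (1-a)/(1+a)` and `v = (1-b)/(1+b)` one has `(1-ab)/(1+ab) = (u+v)/(1+uv) ≤ u+v`;
induct on the factors. The product bound is not strict because the empty product is `1`. -/
theorem one_sub_prod_div_le {ι : Type*} (s : Finset ι) (t : ι → ℝ) (ht : ∀ i, |t i| < 1) :
    |∏ i ∈ s, t i| ≤ 1 ∧ -1 < ∏ i ∈ s, t i ∧
      (1 - ∏ i ∈ s, t i) / (1 + ∏ i ∈ s, t i) ≤ ∑ i ∈ s, (1 - t i) / (1 + t i) := by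
  classical
  induction s using Finset.induction_on with
  | empty => simp
  | insert j s hj ih =>
    obtain ⟨h1, h2, h3⟩ := ih
    rw [Finset.prod_insert hj, Finset.sum_insert hj]
    set p := ∏ i ∈ s, t i
    obtain ⟨hp1, hp2⟩ := abs_le.1 h1
    have hlt : |t j * p| < 1 := by
      rw [abs_mul]
      calc |t j| * |p| ≤ |t j| * 1 := by gcongr
        _ < 1 := by simpa using ht j
    obtain ⟨hj1, hj2⟩ := abs_lt.1 (ht j)
    obtain ⟨hq1, hq2⟩ := abs_lt.1 hlt
    refine ⟨hlt.le, hq1, le_trans ?_ (add_le_add le_rfl h3)⟩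
    rw [div_add_div _ _ (by linarith) (by linarith), div_le_div_iff₀ (by linarith)
      (mul_pos (by linarith) (by linarith))]
    nlinarith [mul_nonneg (sub_nonneg.2 hj2.le) (sub_nonneg.2 hp2), sq_nonneg (1 - t j * p),
      mul_nonneg (mul_nonneg (sub_nonneg.2 hj2.le) (sub_nonneg.2 hp2)) (sub_nonneg.2 hq2.le)]

theorem abs_prod_tanh_lt_one {d : ℕ} (hd : d ≠ 0) (μ : Fin d → ℝ) :
    |∏ i, Real.tanh (μ i / 2)| < 1 := by
  obtain ⟨n, rfl⟩ := Nat.exists_eq_succ_of_ne_zero hd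
  rw [Fin.prod_univ_succ, abs_mul, Finset.abs_prod]
  calc |Real.tanh (μ 0 / 2)| * ∏ i : Fin n, |Real.tanh (μ i.succ / 2)|
      ≤ |Real.tanh (μ 0 / 2)| * 1 := by
        gcongr
        exact Finset.prod_le_one (fun _ _ => abs_nonneg _) fun _ _ => (Real.abs_tanh_lt_one _).le
    _ < 1 := by simpa using Real.abs_tanh_lt_one _

theorem exp_neg_checkUpdate_le {d : ℕ} (hd : d ≠ 0) (μ : Fin d → ℝ) :
    Real.exp (-checkUpdate d μ) ≤ ∑ i, Real.exp (-μ i) := by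
  have h := abs_prod_tanh_lt_one hd μ
  have h1 := (one_sub_prod_div_le Finset.univ (fun i => Real.tanh (μ i / 2))
    fun i => Real.abs_tanh_lt_one _).2.2
  have h2 := one_sub_tanh_div (checkUpdate d μ)
  rw [checkUpdate, mul_div_cancel_left₀ _ two_ne_zero, Real.tanh_artanh (abs_lt.1 h)] at h2
  rw [checkUpdate, ← h2]
  simpa only [one_sub_tanh_div] using h1

theorem exp_half_sq (x : ℝ) : Real.exp (-x / 2) ^ 2 = Real.exp (-x) := by
  rw [← Real.exp_nat_mul]; congr 1; push_cast; ring

/-- Square both sides: a sum of squares of nonnegative numbers is at most the square of their sum.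
-/
theorem exp_neg_checkUpdate_half_le {d : ℕ} (hd : d ≠ 0) (μ : Fin d → ℝ) :
    Real.exp (-checkUpdate d μ / 2) ≤ ∑ i, Real.exp (-μ i / 2) := by
  refine (pow_le_pow_iff_left₀ (Real.exp_pos _).le
    (Finset.sum_nonneg fun _ _ => (Real.exp_pos _).le) two_ne_zero).1 ?_
  rw [exp_half_sq]
  refine (exp_neg_checkUpdate_le hd μ).trans ?_
  simp_rw [← exp_half_sq]
  exact Finset.sum_sq_le_sq_sum_of_nonneg fun _ _ => (Real.exp_pos _).le

/-- All factors have modulus below one, so the product is no larger in modulus than its first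
factor. -/
theorem abs_checkUpdate_le {d : ℕ} (hd : d ≠ 0) {K : ℝ} {μ : Fin d → ℝ}
    (hμ : ∀ i, |μ i| ≤ K) : |checkUpdate d μ| ≤ K := by
  have h := abs_lt.1 (abs_prod_tanh_lt_one hd μ)
  have hle : |∏ i, Real.tanh (μ i / 2)| ≤ Real.tanh (K / 2) := by
    obtain ⟨n, rfl⟩ := Nat.exists_eq_succ_of_ne_zero hd
    have h0 : |Real.tanh (μ 0 / 2)| ≤ Real.tanh (K / 2) := by
      obtain ⟨h1, h2⟩ := abs_le.1 (hμ 0)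
      refine abs_le.2 ⟨?_, tanh_le_tanh (by linarith)⟩
      rw [← Real.tanh_neg]
      exact tanh_le_tanh (by linarith)
    rw [Fin.prod_univ_succ, abs_mul, Finset.abs_prod]
    calc |Real.tanh (μ 0 / 2)| * ∏ i : Fin n, |Real.tanh (μ i.succ / 2)|
        ≤ |Real.tanh (μ 0 / 2)| * 1 := by
          gcongr
          exact Finset.prod_le_one (fun _ _ => abs_nonneg _)
            fun _ _ => (Real.abs_tanh_lt_one _).le
      _ ≤ Real.tanh (K / 2) := by simpa using h0
  obtain ⟨h1, h2⟩ := abs_le.1 hle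
  have h3 := Real.artanh_le_artanh h.1 (Real.tanh_lt_one _) h2
  rw [← Real.tanh_neg] at h1
  have h4 := Real.artanh_le_artanh (Real.neg_one_lt_tanh _) h.2 h1
  rw [Real.artanh_tanh] at h3 h4
  unfold checkUpdate
  exact abs_le.2 ⟨by linarith, by linarith⟩

/-- If all inputs equal `K`, the output is at least `K - log d`. -/
theorem le_checkUpdate_of_eq {d : ℕ} (hd : d ≠ 0) {K : ℝ} {μ : Fin d → ℝ}
    (hμ : ∀ i, μ i = K) : K - Real.log d ≤ checkUpdate d μ := by
  have hd' : (0 : ℝ) < d := by positivity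
  have h := exp_neg_checkUpdate_le hd μ
  simp only [hμ, Finset.sum_const, Finset.card_univ, Fintype.card_fin, nsmul_eq_mul] at h
  rw [← Real.exp_log hd', ← Real.exp_add, Real.exp_le_exp] at h
  linarith

/-! ### Bhattacharyya parameter and tracked quantity as lower Lebesgue integrals -/

noncomputable section

/-- The integrand `e^{-x/2}` of the Bhattacharyya parameter. -/
def bw (x : ℝ) : ℝ≥0∞ := ENNReal.ofReal (Real.exp (-x / 2))

/-- The integrand `e^{-x/2} 1_{x < K}` of the tracked quantity. -/
def tw (K x : ℝ) : ℝ≥0∞ := if x < K then bw x else 0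

end

theorem measurable_bw : Measurable bw := by unfold bw; fun_prop

theorem measurable_tw (K : ℝ) : Measurable (tw K) :=
  Measurable.ite measurableSet_Iio measurable_bw measurable_const

theorem tw_le_bw (K x : ℝ) : tw K x ≤ bw x := by
  unfold tw; split_ifs <;> simp

theorem bw_add (x y : ℝ) : bw (x + y) = bw x * bw y := by
  unfold bw
  rw [← ENNReal.ofReal_mul (Real.exp_pos _).le, ← Real.exp_add]
  congr 2; ring

theorem bw_sum {ι : Type*} (s : Finset ι) (y : ι → ℝ) : bw (∑ i ∈ s, y i) = ∏ i ∈ s, bw (y i) := by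
  classical
  induction s using Finset.induction_on with
  | empty => simp [bw]
  | insert j s hj ih => rw [Finset.sum_insert hj, Finset.prod_insert hj, bw_add, ih]

theorem bw_anti {x y : ℝ} (h : x ≤ y) : bw y ≤ bw x :=
  ENNReal.ofReal_le_ofReal (Real.exp_le_exp.2 (by linarith))

theorem bw_checkUpdate_le {d : ℕ} (hd : d ≠ 0) (μ : Fin d → ℝ) :
    bw (checkUpdate d μ) ≤ ∑ i, bw (μ i) := by
  unfold bw
  rw [← ENNReal.ofReal_sum_of_nonneg fun _ _ => (Real.exp_pos _).le]
  exact ENNReal.ofReal_le_ofReal (exp_neg_checkUpdate_half_le hd μ)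

/-! ### Integrals over independent messages. -/

theorem lintegral_pi_prod {d : ℕ} (β : Measure ℝ) [IsProbabilityMeasure β]
    (f : Fin d → ℝ → ℝ≥0∞) (hf : ∀ i, Measurable (f i)) :
    ∫⁻ y, ∏ i, f i (y i) ∂(Measure.pi fun _ : Fin d => β) = ∏ i, ∫⁻ x, f i x ∂β := by
  rw [ProbabilityTheory.lintegral_prod_eq_prod_lintegral_of_indepFun Finset.univ
    (fun i (y : Fin d → ℝ) => f i (y i))
    (ProbabilityTheory.iIndepFun_pi fun i => (hf i).aemeasurable)
    fun i => (hf i).comp (measurable_pi_apply i)]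
  exact Finset.prod_congr rfl fun i _ =>
    (measurePreserving_eval (fun _ : Fin d => β) i).lintegral_comp (hf i)

theorem lintegral_pi_eval {d : ℕ} (β : Measure ℝ) [IsProbabilityMeasure β] (i : Fin d)
    {f : ℝ → ℝ≥0∞} (hf : Measurable f) :
    ∫⁻ y, f (y i) ∂(Measure.pi fun _ : Fin d => β) = ∫⁻ x, f x ∂β :=
  (measurePreserving_eval (fun _ : Fin d => β) i).lintegral_comp hf

theorem lintegral_pi_eval_mul {d : ℕ} (β : Measure ℝ) [IsProbabilityMeasure β] {i k : Fin d}
    (hik : i ≠ k) {f g : ℝ → ℝ≥0∞} (hf : Measurable f) (hg : Measurable g) :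
    ∫⁻ y, f (y i) * g (y k) ∂(Measure.pi fun _ : Fin d => β) =
      (∫⁻ x, f x ∂β) * ∫⁻ x, g x ∂β := by
  have hind : ProbabilityTheory.iIndepFun (fun (i : Fin d) (y : Fin d → ℝ) => y i)
      (Measure.pi fun _ : Fin d => β) :=
    ProbabilityTheory.iIndepFun_pi (X := fun _ x => x) fun _ => aemeasurable_id
  have := ((hind.indepFun hik).comp hf hg)
  rw [← lintegral_pi_eval β i hf, ← lintegral_pi_eval β k hg]
  exact ProbabilityTheory.lintegral_mul_eq_lintegral_mul_lintegral_of_indepFun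
    (hf.comp (measurable_pi_apply i)) (hg.comp (measurable_pi_apply k)) this

theorem ae_pi_of_ae {d : ℕ} (β : Measure ℝ) [IsProbabilityMeasure β] {p : ℝ → Prop}
    (h : ∀ᵐ x ∂β, p x) : ∀ᵐ y ∂(Measure.pi fun _ : Fin d => β), ∀ i, p (y i) :=
  eventually_all.2 fun i =>
    (measurePreserving_eval (fun _ : Fin d => β) i).quasiMeasurePreserving.ae h

/-! ### Probability and supports along density evolution -/

instance isProbabilityMeasure_checkConv (d : ℕ) (a : Measure ℝ) [IsProbabilityMeasure a] :
    IsProbabilityMeasure (checkConv d a) :=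
  Measure.isProbabilityMeasure_map (measurable_checkUpdate d).aemeasurable

instance isProbabilityMeasure_varConv (c : Measure ℝ) [IsProbabilityMeasure c] (d : ℕ)
    (b : Measure ℝ) [IsProbabilityMeasure b] : IsProbabilityMeasure (varConv c d b) :=
  Measure.isProbabilityMeasure_map (measurable_varUpdate d).aemeasurable

theorem sum_coe_lam {lam : ℕ →₀ ℝ≥0} (hlam : ∑ i ∈ lam.support, lam i = 1) :
    ∑ i ∈ lam.support, (lam i : ℝ≥0∞) = 1 := by
  exact_mod_cast congrArg ((↑) : ℝ≥0 → ℝ≥0∞) hlam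

theorem isProbabilityMeasure_bpStep {lam : ℕ →₀ ℝ≥0} (hlam : ∑ i ∈ lam.support, lam i = 1)
    (dr : ℕ) (c a : Measure ℝ) [IsProbabilityMeasure c] [IsProbabilityMeasure a] :
    IsProbabilityMeasure (bpStep lam dr c a) := by
  constructor
  unfold bpStep
  rw [Measure.finsetSum_apply]
  simp only [Measure.smul_apply, measure_univ]
  refine Eq.trans ?_ (sum_coe_lam hlam)
  exact Finset.sum_congr rfl fun i _ => by simp [ENNReal.smul_def]

theorem isProbabilityMeasure_satStep {lam : ℕ →₀ ℝ≥0} (hlam : ∑ i ∈ lam.support, lam i = 1)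
    (dr : ℕ) (c : Measure ℝ) (K : ℝ) (a : Measure ℝ) [IsProbabilityMeasure c]
    [IsProbabilityMeasure a] : IsProbabilityMeasure (satStep lam dr c K a) := by
  have := isProbabilityMeasure_bpStep hlam dr c a
  exact Measure.isProbabilityMeasure_map (measurable_sat K).aemeasurable

theorem ae_bpStep {lam : ℕ →₀ ℝ≥0} {dr : ℕ} {c a : Measure ℝ} {p : ℝ → Prop}
    (h : ∀ i ∈ lam.support, ∀ᵐ x ∂(varConv c (i - 1) (checkConv dr a)), p x) :
    ∀ᵐ x ∂(bpStep lam dr c a), p x := by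
  unfold bpStep
  rw [ae_finsetSum_measure_iff]
  exact fun i hi => Measure.ae_smul_measure (h i hi) _

theorem lintegral_bpStep (lam : ℕ →₀ ℝ≥0) (dr : ℕ) (c a : Measure ℝ) (f : ℝ → ℝ≥0∞) :
    ∫⁻ x, f x ∂(bpStep lam dr c a) =
      ∑ i ∈ lam.support, lam i * ∫⁻ x, f x ∂(varConv c (i - 1) (checkConv dr a)) := by
  unfold bpStep
  rw [lintegral_finsetSum_measure]
  exact Finset.sum_congr rfl fun i _ => by rw [lintegral_smul_measure]; rfl

theorem measurableSet_abs_le (K : ℝ) : MeasurableSet {x : ℝ | |x| ≤ K} :=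
  measurableSet_le measurable_id.abs measurable_const

theorem ae_abs_checkConv_le {d : ℕ} (hd : d ≠ 0) {K : ℝ} {a : Measure ℝ} [IsProbabilityMeasure a]
    (ha : ∀ᵐ x ∂a, |x| ≤ K) : ∀ᵐ y ∂(checkConv d a), |y| ≤ K := by
  unfold checkConv
  rw [ae_map_iff (measurable_checkUpdate d).aemeasurable (measurableSet_abs_le K)]
  filter_upwards [ae_pi_of_ae a ha] with μ hμ using abs_checkUpdate_le hd hμ

theorem ae_prod_pi {c β : Measure ℝ} [IsProbabilityMeasure c] [IsProbabilityMeasure β] {d : ℕ}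
    {p q : ℝ → Prop} (hc : ∀ᵐ x ∂c, p x) (hβ : ∀ᵐ x ∂β, q x) :
    ∀ᵐ z ∂(c.prod (Measure.pi fun _ : Fin d => β)), p z.1 ∧ ∀ i, q (z.2 i) := by
  have h1 : ∀ᵐ z ∂(c.prod (Measure.pi fun _ : Fin d => β)), p z.1 :=
    Measure.quasiMeasurePreserving_fst.ae hc
  have h2 : ∀ᵐ z ∂(c.prod (Measure.pi fun _ : Fin d => β)), ∀ i, q (z.2 i) :=
    Measure.quasiMeasurePreserving_snd.ae (ae_pi_of_ae β hβ)
  exact h1.and h2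

theorem ae_abs_varConv_le {c β : Measure ℝ} [IsProbabilityMeasure c] [IsProbabilityMeasure β]
    {d : ℕ} {L M : ℝ} (hc : ∀ᵐ x ∂c, |x| ≤ L) (hβ : ∀ᵐ x ∂β, |x| ≤ M) :
    ∀ᵐ x ∂(varConv c d β), |x| ≤ L + d * M := by
  unfold varConv
  rw [ae_map_iff (measurable_varUpdate d).aemeasurable (measurableSet_abs_le _)]
  filter_upwards [ae_prod_pi (d := d) hc hβ] with z hz
  unfold varUpdate
  calc |z.1 + ∑ i, z.2 i| ≤ |z.1| + ∑ i, |z.2 i| :=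
        (abs_add_le _ _).trans (add_le_add le_rfl (Finset.abs_sum_le_sum_abs _ _))
    _ ≤ L + ∑ _i : Fin d, M := add_le_add hz.1 (Finset.sum_le_sum fun i _ => hz.2 i)
    _ = L + d * M := by simp

/-! ### The saturation map. -/

theorem abs_sat_le {K : ℝ} (hK : 0 ≤ K) (x : ℝ) : |sat K x| ≤ K := by
  unfold sat sgn
  rw [abs_mul, abs_of_nonneg (le_min hK (abs_nonneg x))]
  split_ifs <;> simp

theorem ae_abs_satStep_le {lam : ℕ →₀ ℝ≥0} {dr : ℕ} {c : Measure ℝ} {K : ℝ} (hK : 0 ≤ K)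
    {a : Measure ℝ} : ∀ᵐ x ∂(satStep lam dr c K a), |x| ≤ K := by
  unfold satStep
  rw [ae_map_iff (measurable_sat K).aemeasurable (measurableSet_abs_le K)]
  exact Eventually.of_forall fun x => abs_sat_le hK x

theorem sat_of_abs_le {K x : ℝ} (hx : |x| ≤ K) : sat K x = x := by
  unfold sat sgn
  rw [min_eq_right hx]
  split_ifs with h
  · rw [abs_of_neg h]; ring
  · rw [abs_of_nonneg (not_lt.1 h)]; ring

theorem sat_of_le {K x : ℝ} (hK : 0 < K) (hx : K ≤ x) : sat K x = K := by
  unfold sat sgn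
  rw [abs_of_pos (hK.trans_le hx), min_eq_left hx, if_neg (by linarith), mul_one]

theorem le_sat_of_lt {K x : ℝ} (hK : 0 < K) (hx : x < K) : x ≤ sat K x := by
  rcases le_or_gt (-K) x with h | h
  · rw [sat_of_abs_le (abs_le.2 ⟨h, hx.le⟩)]
  · exact h.le.trans (abs_le.1 (abs_sat_le hK.le x)).1

/-! ### One step bounds on the Bhattacharyya parameter -/

theorem lintegral_bw_checkConv_le {d : ℕ} (hd : d ≠ 0) (a : Measure ℝ) [IsProbabilityMeasure a] :
    ∫⁻ x, bw x ∂(checkConv d a) ≤ d * ∫⁻ x, bw x ∂a := by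
  unfold checkConv
  rw [lintegral_map measurable_bw (measurable_checkUpdate d)]
  calc _ ≤ ∫⁻ μ, ∑ i, bw (μ i) ∂(Measure.pi fun _ : Fin d => a) :=
        lintegral_mono fun μ => bw_checkUpdate_le hd μ
    _ = ∑ i : Fin d, ∫⁻ μ, bw (μ i) ∂(Measure.pi fun _ : Fin d => a) :=
        lintegral_finsetSum _ fun i _ => measurable_bw.comp (measurable_pi_apply i)
    _ = d * ∫⁻ x, bw x ∂a := by simp [lintegral_pi_eval a _ measurable_bw]

theorem lintegral_prod_pi_prod (c β : Measure ℝ) [IsProbabilityMeasure β] {d : ℕ}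
    {g : ℝ → ℝ≥0∞} {f : Fin d → ℝ → ℝ≥0∞} (hg : Measurable g) (hf : ∀ i, Measurable (f i)) :
    ∫⁻ z, g z.1 * ∏ i, f i (z.2 i) ∂(c.prod (Measure.pi fun _ : Fin d => β)) =
      (∫⁻ x, g x ∂c) * ∏ i, ∫⁻ x, f i x ∂β := by
  have h : Measurable fun y : Fin d → ℝ => ∏ i, f i (y i) :=
    Finset.measurable_prod _ fun i _ => (hf i).comp (measurable_pi_apply i)
  rw [lintegral_prod_mul (g := fun y : Fin d → ℝ => ∏ i, f i (y i)) hg.aemeasurable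
    h.aemeasurable, lintegral_pi_prod β f hf]

theorem lintegral_bw_varConv (c β : Measure ℝ) [IsProbabilityMeasure β] (d : ℕ) :
    ∫⁻ x, bw x ∂(varConv c d β) = (∫⁻ x, bw x ∂c) * (∫⁻ x, bw x ∂β) ^ d := by
  unfold varConv
  rw [lintegral_map measurable_bw (measurable_varUpdate d)]
  simp only [varUpdate, bw_add, bw_sum]
  rw [lintegral_prod_pi_prod c β (f := fun _ => bw) measurable_bw fun _ => measurable_bw]
  simp

/-- Clipping at `-K` only lowers the integrand, and clipping at `K` produces the value `bw K`. This
is the source of the floor `e^{-K/2}`. -/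
theorem bw_sat_le {K : ℝ} (hK : 0 < K) (x : ℝ) : bw (sat K x) ≤ bw x + bw K := by
  rcases lt_or_ge x K with h | h
  · exact (bw_anti (le_sat_of_lt hK h)).trans le_self_add
  · rw [sat_of_le hK h]; exact le_add_self

/-- Symmetry tested on the constant `1` gives `∫ e^{-x} = 1`; then apply `e^{-x/2} ≤ (1 +
e^{-x})/2`. -/
theorem lintegral_bw_le_one {c : Measure ℝ} [IsProbabilityMeasure c] (hsym : IsSymmetric c) :
    ∫⁻ x, bw x ∂c ≤ 1 := by
  have h := hsym (BoundedContinuousFunction.const ℝ 1)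
  simp only [BoundedContinuousFunction.const_apply, mul_one, integral_const, probReal_univ,
    smul_eq_mul] at h
  -- A non-integrable function would have Bochner integral `0`, contradicting the value `1`.
  have hint : Integrable (fun x => Real.exp (-x)) c := by
    by_contra hn
    rw [integral_undef hn] at h
    norm_num at h
  calc ∫⁻ x, bw x ∂c ≤ ∫⁻ x, ENNReal.ofReal ((1 + Real.exp (-x)) / 2) ∂c := by
        refine lintegral_mono fun x => ENNReal.ofReal_le_ofReal ?_
        rw [← exp_half_sq]
        nlinarith [sq_nonneg (1 - Real.exp (-x / 2))]
    _ = ENNReal.ofReal (∫ x, (1 + Real.exp (-x)) / 2 ∂c) :=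
        (ofReal_integral_eq_lintegral_ofReal (((integrable_const 1).add hint).div_const 2)
          (Eventually.of_forall fun x => by dsimp; positivity)).symm
    _ = 1 := by
        rw [integral_div, integral_add (integrable_const 1) hint, ← h]
        simp

theorem lintegral_bpStep_le {lam : ℕ →₀ ℝ≥0} (hlam : ∑ i ∈ lam.support, lam i = 1)
    {dr : ℕ} {c a : Measure ℝ} {f : ℝ → ℝ≥0∞} {C : ℝ≥0∞}
    (h : ∀ i ∈ lam.support, ∫⁻ x, f x ∂(varConv c (i - 1) (checkConv dr a)) ≤ C) :
    ∫⁻ x, f x ∂(bpStep lam dr c a) ≤ C := by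
  rw [lintegral_bpStep]
  calc _ ≤ ∑ i ∈ lam.support, lam i * C := Finset.sum_le_sum fun i hi => by gcongr; exact h i hi
    _ = C := by rw [← Finset.sum_mul, sum_coe_lam hlam, one_mul]

theorem lintegral_bw_satStep_le {lam : ℕ →₀ ℝ≥0} (hlam : ∑ i ∈ lam.support, lam i = 1)
    (hmin : ∀ i ∈ lam.support, 5 ≤ i) {dr : ℕ} (hdr : dr ≠ 0) {c a : Measure ℝ}
    [IsProbabilityMeasure c] [IsProbabilityMeasure a] (hc : ∫⁻ x, bw x ∂c ≤ 1) {K : ℝ}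
    (hK : 0 < K) (hle : dr * ∫⁻ x, bw x ∂a ≤ 1) :
    ∫⁻ x, bw x ∂(satStep lam dr c K a) ≤ (dr * ∫⁻ x, bw x ∂a) ^ 4 + bw K := by
  have := isProbabilityMeasure_bpStep hlam dr c a
  unfold satStep
  rw [lintegral_map measurable_bw (measurable_sat K)]
  calc _ ≤ ∫⁻ x, (bw x + bw K) ∂(bpStep lam dr c a) := lintegral_mono fun x => bw_sat_le hK x
    _ = ∫⁻ x, bw x ∂(bpStep lam dr c a) + bw K := by
        rw [lintegral_add_right _ measurable_const]; simp
    _ ≤ _ := by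
        gcongr
        refine lintegral_bpStep_le hlam fun i hi => ?_
        have h5 := hmin i hi
        rw [lintegral_bw_varConv]
        calc _ ≤ 1 * (dr * ∫⁻ x, bw x ∂a) ^ (i - 1) := by
              gcongr
              exact lintegral_bw_checkConv_le hdr a
          _ ≤ (dr * ∫⁻ x, bw x ∂a) ^ 4 := by
              rw [one_mul]
              exact pow_le_pow_of_le_one (zero_le) hle (by omega)

/-! ### One step bound on the tracked quantity -/

/-- When the output is below `K - log d`, some input `μ j` is below `K`. Each input equal to `K`
then satisfies `bw K ≤ bw (μ j)` and is charged to a different index, so the two factors in the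
cross terms are independent. -/
theorem tw_checkUpdate_le {d : ℕ} (hd : d ≠ 0) {K : ℝ} {μ : Fin d → ℝ}
    (hμ : ∀ i, μ i ≤ K) : tw (K - Real.log d) (checkUpdate d μ) ≤
      ∑ k, (tw K (μ k) +
        ∑ i ∈ Finset.univ.erase k, tw K (μ i) * ({K} : Set ℝ).indicator 1 (μ k)) := by
  by_cases hy : checkUpdate d μ < K - Real.log d
  · obtain ⟨j, hj⟩ : ∃ j, μ j < K := by
      by_contra! h
      exact absurd (le_checkUpdate_of_eq hd fun i => (hμ i).antisymm (h i)) (not_le.2 hy)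
    refine (tw_le_bw _ _).trans ((bw_checkUpdate_le hd μ).trans (Finset.sum_le_sum fun k _ => ?_))
    rcases (hμ k).lt_or_eq with hk | hk
    · rw [tw, if_pos hk]; exact le_self_add
    · have hjk : j ≠ k := by rintro rfl; exact hj.ne hk
      calc bw (μ k) ≤ bw (μ j) := bw_anti (by linarith)
        _ = tw K (μ j) * ({K} : Set ℝ).indicator 1 (μ k) := by simp [tw, hj, hk]
        _ ≤ ∑ i ∈ Finset.univ.erase k, tw K (μ i) * ({K} : Set ℝ).indicator 1 (μ k) :=
            Finset.single_le_sum
              (f := fun i => tw K (μ i) * ({K} : Set ℝ).indicator 1 (μ k))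
              (fun _ _ => zero_le) (Finset.mem_erase.2 ⟨hjk, Finset.mem_univ _⟩)
        _ ≤ _ := le_add_self
  · rw [tw, if_neg hy]; exact zero_le

theorem lintegral_tw_checkConv_le {d : ℕ} (hd : d ≠ 0) {K : ℝ} {a : Measure ℝ}
    [IsProbabilityMeasure a] (ha : ∀ᵐ x ∂a, |x| ≤ K) :
    ∫⁻ x, tw (K - Real.log d) x ∂(checkConv d a) ≤
      d * (∫⁻ x, tw K x ∂a) * (1 + (d - 1 : ℕ) * a {K}) := by
  have hI : Measurable (({K} : Set ℝ).indicator (1 : ℝ → ℝ≥0∞)) :=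
    measurable_one.indicator (measurableSet_singleton K)
  have hev : ∀ k : Fin d, Measurable fun μ : Fin d → ℝ => μ k := fun k => measurable_pi_apply k
  have h1 : ∀ i k : Fin d, Measurable fun μ : Fin d → ℝ =>
      tw K (μ i) * ({K} : Set ℝ).indicator 1 (μ k) :=
    fun i k => ((measurable_tw K).comp (hev i)).mul (hI.comp (hev k))
  have h2 : ∀ k : Fin d, Measurable fun μ : Fin d → ℝ =>
      ∑ i ∈ Finset.univ.erase k, tw K (μ i) * ({K} : Set ℝ).indicator 1 (μ k) :=
    fun k => Finset.measurable_sum _ fun i _ => h1 i k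
  unfold checkConv
  rw [lintegral_map (measurable_tw _) (measurable_checkUpdate d)]
  calc _ ≤ ∫⁻ μ, ∑ k, (tw K (μ k) + ∑ i ∈ Finset.univ.erase k,
          tw K (μ i) * ({K} : Set ℝ).indicator 1 (μ k)) ∂(Measure.pi fun _ : Fin d => a) := by
        refine lintegral_mono_ae ?_
        filter_upwards [ae_pi_of_ae a ha] with μ hμ
        exact tw_checkUpdate_le hd fun i => (abs_le.1 (hμ i)).2
    _ = ∑ _k : Fin d, ((∫⁻ x, tw K x ∂a) + (d - 1 : ℕ) * ((∫⁻ x, tw K x ∂a) * a {K})) := by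
        have h3 : ∀ k : Fin d, Measurable fun μ : Fin d → ℝ => tw K (μ k) +
            ∑ i ∈ Finset.univ.erase k, tw K (μ i) * ({K} : Set ℝ).indicator 1 (μ k) :=
          fun k => ((measurable_tw K).comp (hev k)).add (h2 k)
        rw [lintegral_finsetSum _ fun k _ => h3 k]
        refine Finset.sum_congr rfl fun k _ => ?_
        rw [lintegral_add_right _ (h2 k), lintegral_pi_eval a k (measurable_tw K),
          lintegral_finsetSum _ fun i _ => h1 i k]
        congr 1
        rw [Finset.sum_congr rfl fun i hi =>
          lintegral_pi_eval_mul a (Finset.ne_of_mem_erase hi) (measurable_tw K) hI]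
        rw [lintegral_indicator_one (measurableSet_singleton K)]
        simp
    _ = _ := by
        rw [Finset.sum_const, Finset.card_univ, Fintype.card_fin, nsmul_eq_mul]
        ring

/-- Union bound over ordered pairs of inputs below `θ`. With at most one such input, the output is
at least `-L - K + 3θ ≥ K` and the left side vanishes. -/
theorem tw_varUpdate_le {d : ℕ} (hd : 4 ≤ d) {K L θ : ℝ} (hθ : 0 ≤ θ)
    (hK : 2 * K + L ≤ 3 * θ) {z : ℝ × (Fin d → ℝ)} (hz : -L ≤ z.1) (hy : ∀ i, -K ≤ z.2 i) :
    tw K (varUpdate d z) ≤ ∑ p ∈ (Finset.univ : Finset (Fin d)).offDiag,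
      bw z.1 * ∏ i, (if i = p.1 ∨ i = p.2 then tw θ else bw) (z.2 i) := by
  by_cases hp : ∃ i j, i ≠ j ∧ z.2 i < θ ∧ z.2 j < θ
  · obtain ⟨i, j, hij, hi, hj⟩ := hp
    have hterm : tw K (varUpdate d z) ≤
        bw z.1 * ∏ l, (if l = i ∨ l = j then tw θ else bw) (z.2 l) := by
      refine (tw_le_bw _ _).trans_eq ?_
      rw [varUpdate, bw_add, bw_sum]
      congr 1
      refine Finset.prod_congr rfl fun l _ => ?_
      split_ifs with h
      · rcases h with rfl | rfl
        · rw [tw, if_pos hi]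
        · rw [tw, if_pos hj]
      · rfl
    have hmem : (i, j) ∈ (Finset.univ : Finset (Fin d)).offDiag :=
      Finset.mem_offDiag.2 ⟨Finset.mem_univ i, Finset.mem_univ j, hij⟩
    refine hterm.trans ?_
    set f : Fin d × Fin d → ℝ≥0∞ := fun p =>
      bw z.1 * ∏ l, (if l = p.1 ∨ l = p.2 then tw θ else bw) (z.2 l)
    exact Finset.single_le_sum (f := f) (fun _ _ => zero_le) hmem
  · push Not at hp
    -- The exceptional index; if every input reaches `θ`, an arbitrary one serves.
    obtain ⟨j, hj⟩ : ∃ j, ∀ i, i ≠ j → θ ≤ z.2 i := by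
      by_cases h : ∃ j, z.2 j < θ
      · obtain ⟨j, hj⟩ := h
        exact ⟨j, fun i hi => hp j i hi.symm hj⟩
      · push Not at h
        exact ⟨⟨0, by omega⟩, fun i _ => h i⟩
    have hsum : 3 * θ ≤ ∑ i ∈ Finset.univ.erase j, z.2 i := by
      have hcard : ((Finset.univ.erase j).card : ℝ) = d - 1 := by
        rw [Finset.card_erase_of_mem (Finset.mem_univ j), Finset.card_univ, Fintype.card_fin,
          Nat.cast_sub (by omega), Nat.cast_one]
      have h := Finset.card_nsmul_le_sum (Finset.univ.erase j) z.2 θ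
        fun i hi => hj i (Finset.ne_of_mem_erase hi)
      rw [nsmul_eq_mul, hcard] at h
      have hd' : (4 : ℝ) ≤ d := by exact_mod_cast hd
      nlinarith
    rw [tw, if_neg]
    · exact zero_le
    · rw [varUpdate, ← Finset.add_sum_erase _ _ (Finset.mem_univ j)]
      have := hy j
      linarith

/-- By independence each pair contributes two truncated integrals and `d - 2` full ones; the channel
factor is at most one, and there are at most `d ^ 2` ordered pairs. -/
theorem lintegral_tw_varConv_le {d : ℕ} (hd : 4 ≤ d) {K L θ : ℝ} (hθ : 0 ≤ θ)
    (hK : 2 * K + L ≤ 3 * θ) {c β : Measure ℝ} [IsProbabilityMeasure c] [IsProbabilityMeasure β]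
    (hcL : ∀ᵐ x ∂c, |x| ≤ L) (hc : ∫⁻ x, bw x ∂c ≤ 1) (hβ : ∀ᵐ x ∂β, |x| ≤ K) :
    ∫⁻ x, tw K x ∂(varConv c d β) ≤
      d ^ 2 * (∫⁻ x, bw x ∂β) ^ (d - 2) * (∫⁻ x, tw θ x ∂β) ^ 2 := by
  have hf : ∀ (p : Fin d × Fin d) (i : Fin d),
      Measurable (if i = p.1 ∨ i = p.2 then tw θ else bw) := by
    intro p i
    split_ifs
    · exact measurable_tw θ
    · exact measurable_bw
  unfold varConv
  rw [lintegral_map (measurable_tw K) (measurable_varUpdate d)]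
  calc _ ≤ ∫⁻ z, ∑ p ∈ (Finset.univ : Finset (Fin d)).offDiag,
        bw z.1 * ∏ i, (if i = p.1 ∨ i = p.2 then tw θ else bw) (z.2 i)
          ∂(c.prod (Measure.pi fun _ : Fin d => β)) := by
        refine lintegral_mono_ae ?_
        filter_upwards [ae_prod_pi (d := d) hcL hβ] with z hz
        exact tw_varUpdate_le hd hθ hK (abs_le.1 hz.1).1 fun i => (abs_le.1 (hz.2 i)).1
    _ = ∑ p ∈ (Finset.univ : Finset (Fin d)).offDiag, (∫⁻ x, bw x ∂c) *
          ∏ i, ∫⁻ x, (if i = p.1 ∨ i = p.2 then tw θ else bw) x ∂β := by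
        have hm : ∀ p : Fin d × Fin d, Measurable fun z : ℝ × (Fin d → ℝ) =>
            bw z.1 * ∏ i, (if i = p.1 ∨ i = p.2 then tw θ else bw) (z.2 i) :=
          fun p => (measurable_bw.comp measurable_fst).mul (Finset.measurable_prod _ fun i _ =>
            (hf p i).comp ((measurable_pi_apply i).comp measurable_snd))
        rw [lintegral_finsetSum _ fun p _ => hm p]
        exact Finset.sum_congr rfl fun p _ => lintegral_prod_pi_prod c β measurable_bw (hf p)
    _ ≤ ∑ p ∈ (Finset.univ : Finset (Fin d)).offDiag,
          (∫⁻ x, bw x ∂β) ^ (d - 2) * (∫⁻ x, tw θ x ∂β) ^ 2 := by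
        refine Finset.sum_le_sum fun p hp => ?_
        have hne : p.1 ≠ p.2 := (Finset.mem_offDiag.1 hp).2.2
        have hprod : ∏ i, ∫⁻ x, (if i = p.1 ∨ i = p.2 then tw θ else bw) x ∂β =
            (∫⁻ x, bw x ∂β) ^ (d - 2) * (∫⁻ x, tw θ x ∂β) ^ 2 := by
          have h : ∀ i : Fin d, ∫⁻ x, (if i = p.1 ∨ i = p.2 then tw θ else bw) x ∂β =
              if i ∈ ({p.1, p.2} : Finset (Fin d)) then ∫⁻ x, tw θ x ∂β else ∫⁻ x, bw x ∂β := by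
            intro i
            simp only [Finset.mem_insert, Finset.mem_singleton]
            split_ifs <;> rfl
          rw [Finset.prod_congr rfl fun i _ => h i, Finset.prod_ite, Finset.prod_const,
            Finset.prod_const, Finset.filter_mem_eq_inter, Finset.univ_inter,
            Finset.card_pair hne, mul_comm]
          congr 2
          rw [← Finset.compl_filter, Finset.card_compl, Finset.filter_mem_eq_inter,
            Finset.univ_inter, Finset.card_pair hne, Fintype.card_fin]
        rw [hprod]
        exact mul_le_of_le_one_left' hc
    _ ≤ _ := by
        rw [Finset.sum_const, nsmul_eq_mul, mul_assoc]
        gcongr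
        rw [Finset.offDiag_card, Finset.card_univ, Fintype.card_fin]
        exact_mod_cast (Nat.sub_le _ _).trans_eq (sq d).symm

theorem tw_sat_le {K : ℝ} (hK : 0 < K) (x : ℝ) : tw K (sat K x) ≤ tw K x := by
  rcases lt_or_ge x K with h | h
  · exact (tw_le_bw _ _).trans ((bw_anti (le_sat_of_lt hK h)).trans_eq (by rw [tw, if_pos h]))
  · simp [sat_of_le hK h, tw]

theorem lintegral_tw_satStep_le {lam : ℕ →₀ ℝ≥0} (hlam : ∑ i ∈ lam.support, lam i = 1)
    (hmin : ∀ i ∈ lam.support, 5 ≤ i) {D : ℕ} (hD : ∀ i ∈ lam.support, i ≤ D) {dr : ℕ}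
    (hdr : dr ≠ 0) {K L : ℝ} (hK : 0 < K) (hKL : L + 3 * Real.log dr ≤ K)
    (hKl : Real.log dr ≤ K) {c a : Measure ℝ} [IsProbabilityMeasure c] [IsProbabilityMeasure a]
    (hcL : ∀ᵐ x ∂c, |x| ≤ L) (hc : ∫⁻ x, bw x ∂c ≤ 1) (ha : ∀ᵐ x ∂a, |x| ≤ K)
    (hle : dr * ∫⁻ x, bw x ∂a ≤ 1) (hDle : D * (dr * ∫⁻ x, bw x ∂a) ≤ 1) :
    ∫⁻ x, tw K x ∂(satStep lam dr c K a) ≤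
      (dr * (∫⁻ x, tw K x ∂a) * (1 + (dr - 1 : ℕ) * a {K})) ^ 2 := by
  unfold satStep
  rw [lintegral_map (measurable_tw K) (measurable_sat K)]
  refine (lintegral_mono fun x => tw_sat_le hK x).trans (lintegral_bpStep_le hlam fun i hi => ?_)
  have h5 := hmin i hi
  have hB := lintegral_bw_checkConv_le hdr a
  set B := ∫⁻ x, bw x ∂(checkConv dr a)
  -- Since `5 ≤ i`, at least two messages remain outside the pair, and `B ^ 2` absorbs the number of
  -- pairs.
  have hfac : ((i - 1 : ℕ) : ℝ≥0∞) ^ 2 * B ^ (i - 1 - 2) ≤ 1 := by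
    calc _ ≤ (D : ℝ≥0∞) ^ 2 * B ^ 2 := by
          refine mul_le_mul' ?_ ?_
          · gcongr
            exact (Nat.sub_le i 1).trans (hD i hi)
          · exact pow_le_pow_of_le_one zero_le (hB.trans hle) (by omega)
      _ = (D * B) ^ 2 := (mul_pow _ _ _).symm
      _ ≤ 1 := pow_le_one₀ zero_le ((mul_le_mul_right hB _).trans hDle)
  calc _ ≤ ((i - 1 : ℕ) : ℝ≥0∞) ^ 2 * B ^ (i - 1 - 2) *
        (∫⁻ x, tw (K - Real.log dr) x ∂(checkConv dr a)) ^ 2 :=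
        lintegral_tw_varConv_le (by omega) (by linarith) (by linarith) hcL hc
          (ae_abs_checkConv_le hdr ha)
    _ ≤ (∫⁻ x, tw (K - Real.log dr) x ∂(checkConv dr a)) ^ 2 := mul_le_of_le_one_left' hfac
    _ ≤ _ := by
        gcongr
        exact lintegral_tw_checkConv_le hdr ha

/-! ### Comparison with the real-valued quantities -/

theorem batta_eq_toReal (a : Measure ℝ) : batta a = (∫⁻ x, bw x ∂a).toReal := by
  unfold batta
  rw [integral_eq_lintegral_of_nonneg_ae (Eventually.of_forall fun x => (Real.exp_pos _).le)
    (by fun_prop)]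
  rfl

theorem lintegral_bw_ne_top {K : ℝ} {a : Measure ℝ} [IsProbabilityMeasure a]
    (ha : ∀ᵐ x ∂a, |x| ≤ K) : ∫⁻ x, bw x ∂a ≠ ∞ := by
  have : ∫⁻ x, bw x ∂a ≤ ∫⁻ _, bw (-K) ∂a := by
    refine lintegral_mono_ae ?_
    filter_upwards [ha] with x hx using bw_anti (abs_le.1 hx).1
  refine ne_top_of_le_ne_top ?_ this
  simp [bw]

/-- If the saturated mass vanishes, then `satErr` takes the junk value `0`, but the atom at `-K` is
null as well. -/
theorem satMass_mul_satErr {K : ℝ} (hK : 0 < K) (a : Measure ℝ) [IsProbabilityMeasure a] :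
    satMass K a * satErr K a = a.real {-K} := by
  unfold satErr
  by_cases h : satMass K a = 0
  · have hle : a.real {-K} ≤ satMass K a :=
      measureReal_mono (by rintro x rfl; simp [abs_of_pos hK])
    rw [h] at hle
    rw [h, zero_mul]
    exact (hle.antisymm measureReal_nonneg).symm
  · exact mul_div_cancel₀ _ h

theorem satMass_eq {K : ℝ} (hK : 0 < K) (a : Measure ℝ) [IsProbabilityMeasure a] :
    satMass K a = a.real {-K} + a.real {K} := by
  unfold satMass
  rw [← measureReal_union (by simp; linarith) (measurableSet_singleton K)]
  congr 1
  ext x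
  simp only [mem_ofPred_eq, mem_union, mem_singleton_iff, abs_eq hK.le]
  tauto

theorem satErr_mem_Icc {K : ℝ} (hK : 0 < K) (a : Measure ℝ) [IsProbabilityMeasure a] :
    0 ≤ satErr K a ∧ satErr K a ≤ 1 := by
  have h := satMass_eq hK a
  unfold satErr
  exact ⟨div_nonneg measureReal_nonneg measureReal_nonneg,
    div_le_one_of_le₀ (by rw [h]; linarith [measureReal_nonneg (μ := a) (s := {K})])
      measureReal_nonneg⟩

theorem batta_twoPoint {p : ℝ} (hp0 : 0 ≤ p) (hp1 : p ≤ 1) (K : ℝ) :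
    batta (twoPoint p K) = p * Real.exp (K / 2) + (1 - p) * Real.exp (-K / 2) := by
  unfold batta twoPoint
  have hi : ∀ y : ℝ, Integrable (fun x : ℝ => Real.exp (-x / 2)) (Measure.dirac y) :=
    fun y => integrable_dirac (by simp)
  rw [integral_add_measure ((hi _).smul_measure ENNReal.ofReal_ne_top)
    ((hi _).smul_measure ENNReal.ofReal_ne_top), integral_smul_measure, integral_smul_measure,
    integral_dirac, integral_dirac, ENNReal.toReal_ofReal hp0,
    ENNReal.toReal_ofReal (by linarith), smul_eq_mul, smul_eq_mul, neg_neg]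

theorem xi_eq {K : ℝ} (hK : 0 < K) (dr : ℕ) (a : Measure ℝ) [IsProbabilityMeasure a] :
    xi dr K a = ((dr : ℝ) - 1) * (Real.exp K * a.real {-K} + a.real {K}) + 1 := by
  obtain ⟨h0, h1⟩ := satErr_mem_Icc hK a
  unfold xi
  rw [batta_twoPoint h0 h1]
  have e1 : Real.exp (K / 2) * Real.exp (K / 2) = Real.exp K := by
    rw [← Real.exp_add]; congr 1; ring
  have e2 : Real.exp (K / 2) * Real.exp (-K / 2) = 1 := by
    rw [← Real.exp_add, ← Real.exp_zero]; congr 1; ring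
  have h2 := satMass_mul_satErr hK a
  have h3 := satMass_eq hK a
  have h4 : satMass K a * (1 - satErr K a) = a.real {K} := by rw [mul_sub, h2, h3]; ring
  rw [← h4, ← h2, ← e1]
  linear_combination ((dr : ℝ) - 1) * satMass K a * (1 - satErr K a) * e2

/-- On `[-K, K]`, the region `x < K` splits into the open interval and the atom at `-K`; these are
the two terms of `tracked`. -/
theorem tracked_eq_toReal {K : ℝ} (hK : 0 < K) {a : Measure ℝ} [IsProbabilityMeasure a]
    (ha : ∀ᵐ x ∂a, |x| ≤ K) : tracked K a = (∫⁻ x, tw K x ∂a).toReal := by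
  have hsplit : ∫⁻ x, tw K x ∂a = ∫⁻ x in Ioo (-K) K, bw x ∂a + bw (-K) * a {-K} := by
    have h : ∀ᵐ x ∂a, tw K x =
        (Ioo (-K) K).indicator bw x + ({-K} : Set ℝ).indicator (fun _ => bw (-K)) x := by
      filter_upwards [ha] with x hx
      obtain ⟨h1, h2⟩ := abs_le.1 hx
      rcases h1.lt_or_eq with h1 | h1
      · rcases h2.lt_or_eq with h2 | h2
        · simp [tw, h1, h2, h1.ne']
        · have : K ≠ -K := by linarith
          simp [tw, h2, this]
      · subst h1
        have : -K < K := by linarith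
        simp [tw, this]
    rw [lintegral_congr_ae h, lintegral_add_left (measurable_bw.indicator measurableSet_Ioo),
      lintegral_indicator measurableSet_Ioo, lintegral_indicator (measurableSet_singleton _),
      setLIntegral_const]
  have hmass : a (Ioo (-K) K) = ENNReal.ofReal (1 - satMass K a) := by
    have hu : a.real (Ioo (-K) K) = 1 - satMass K a := by
      unfold satMass
      have hm : MeasurableSet {x : ℝ | |x| = K} :=
        measurableSet_eq_fun measurable_id.abs measurable_const
      rw [← probReal_compl_eq_one_sub hm]
      refine measureReal_congr ?_
      filter_upwards [ha] with x hx
      refine propext ?_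
      change x ∈ Ioo (-K) K ↔ ¬ |x| = K
      rw [mem_Ioo, ← abs_lt]
      exact ⟨fun h => h.ne, fun h => lt_of_le_of_ne hx h⟩
    rw [← hu, ofReal_measureReal]
  have hun : (1 - satMass K a) * batta (unsat K a) =
      (∫⁻ x in Ioo (-K) K, bw x ∂a).toReal := by
    rw [batta_eq_toReal, unsat, ProbabilityTheory.cond, lintegral_smul_measure, hmass,
      smul_eq_mul, ENNReal.toReal_mul, ENNReal.toReal_inv]
    have h0 : 0 ≤ 1 - satMass K a := sub_nonneg.2 measureReal_le_one
    rw [ENNReal.toReal_ofReal h0]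
    by_cases hz : 1 - satMass K a = 0
    · rw [hz, ENNReal.ofReal_zero] at hmass
      rw [Measure.restrict_eq_zero.2 hmass]
      simp
    · rw [mul_inv_cancel_left₀ hz]
  have hfin : ∫⁻ x in Ioo (-K) K, bw x ∂a ≠ ∞ :=
    ne_top_of_le_ne_top (lintegral_bw_ne_top ha) (setLIntegral_le_lintegral _ _)
  rw [tracked, hun, satMass_mul_satErr hK, hsplit, ENNReal.toReal_add hfin
    (ENNReal.mul_ne_top (by simp [bw]) (measure_ne_top _ _)), ENNReal.toReal_mul]
  simp [bw, Measure.real, (Real.exp_pos _).le]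

theorem perr_le_tracked {K : ℝ} (hK : 0 < K) {a : Measure ℝ} [IsProbabilityMeasure a]
    (ha : ∀ᵐ x ∂a, |x| ≤ K) : perr a ≤ tracked K a := by
  have h1 : perr a ≤ a.real (Iic 0) := by
    have h : a.real (Iic 0) = a.real (Iio 0) + a.real {0} := by
      rw [← measureReal_union (by simp) (measurableSet_singleton _)]
      congr 1
      ext x
      simp [le_iff_lt_or_eq]
    rw [perr, h]
    linarith [measureReal_nonneg (μ := a) (s := {0})]
  refine h1.trans ?_
  rw [tracked_eq_toReal hK ha]
  refine ENNReal.toReal_mono (ne_top_of_le_ne_top (lintegral_bw_ne_top ha)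
    (lintegral_mono fun x => tw_le_bw K x)) ?_
  rw [← lintegral_indicator_one measurableSet_Iic]
  refine lintegral_mono fun x => ?_
  by_cases hx : x ≤ 0
  · rw [indicator_of_mem (mem_Iic.2 hx), tw, if_pos (by linarith), bw]
    simp only [Pi.one_apply, ENNReal.one_le_ofReal, Real.one_le_exp_iff]
    linarith
  · rw [indicator_of_notMem (by simpa using hx)]; exact zero_le

/-- The atom at `-K` contributes `e^{K/2} a{-K}` to `𝔅(a)`, so `e^K a{-K} ≤ 2`. With `a{K} ≤ 1` this
gives `ξ ≤ 3(dr - 1) + 1`. -/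
theorem xi_le {K : ℝ} (hK : 0 < K) {dr : ℕ} (hdr : 1 ≤ dr) {a : Measure ℝ}
    [IsProbabilityMeasure a] (ha : ∀ᵐ x ∂a, |x| ≤ K)
    (hb : batta a ≤ 2 * Real.exp (-K / 2)) : xi dr K a ≤ 3 * (dr : ℝ) := by
  have hneg : Real.exp (K / 2) * a.real {-K} ≤ batta a := by
    rw [batta_eq_toReal]
    have h : bw (-K) * a {-K} ≤ ∫⁻ x, bw x ∂a := by
      rw [← lintegral_singleton]
      exact setLIntegral_le_lintegral _ _
    have := ENNReal.toReal_mono (lintegral_bw_ne_top ha) h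
    simpa [bw, Measure.real, (Real.exp_pos _).le] using this
  have hexp : Real.exp K * a.real {-K} ≤ 2 := by
    have e1 : Real.exp (K / 2) * Real.exp (K / 2) = Real.exp K := by
      rw [← Real.exp_add]; congr 1; ring
    have e2 : Real.exp (K / 2) * Real.exp (-K / 2) = 1 := by
      rw [← Real.exp_add, ← Real.exp_zero]; congr 1; ring
    have := mul_le_mul_of_nonneg_left (hneg.trans hb) (Real.exp_pos (K / 2)).le
    rw [← e1]
    linarith
  have hone : a.real {K} ≤ 1 := measureReal_le_one
  have hdr' : (1 : ℝ) ≤ dr := by exact_mod_cast hdr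
  rw [xi_eq hK]
  nlinarith

/-! ### Real-valued one step bounds -/

theorem batta_satStep_le {lam : ℕ →₀ ℝ≥0} (hlam : ∑ i ∈ lam.support, lam i = 1)
    (hmin : ∀ i ∈ lam.support, 5 ≤ i) {dr : ℕ} (hdr : dr ≠ 0) {c a : Measure ℝ}
    [IsProbabilityMeasure c] [IsProbabilityMeasure a] (hc : ∫⁻ x, bw x ∂c ≤ 1) {K : ℝ}
    (hK : 0 < K) (ha : ∀ᵐ x ∂a, |x| ≤ K) (hle : dr * batta a ≤ 1) :
    batta (satStep lam dr c K a) ≤ (dr * batta a) ^ 4 + Real.exp (-K / 2) := by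
  have hb : ∫⁻ x, bw x ∂a = ENNReal.ofReal (batta a) := by
    rw [batta_eq_toReal, ENNReal.ofReal_toReal (lintegral_bw_ne_top ha)]
  have h0 : 0 ≤ batta a := by rw [batta_eq_toReal]; exact ENNReal.toReal_nonneg
  have hmul : (dr : ℝ≥0∞) * ∫⁻ x, bw x ∂a = ENNReal.ofReal (dr * batta a) := by
    rw [ENNReal.ofReal_mul (Nat.cast_nonneg _), ENNReal.ofReal_natCast, hb]
  have h := lintegral_bw_satStep_le hlam hmin hdr hc hK
    (by rw [hmul]; exact ENNReal.ofReal_le_one.2 hle)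
  have hnn : 0 ≤ (dr : ℝ) * batta a := by positivity
  rw [hmul, ← ENNReal.ofReal_pow hnn, bw, ← ENNReal.ofReal_add (by positivity)
    (Real.exp_pos _).le] at h
  rw [batta_eq_toReal]
  exact ENNReal.toReal_le_of_le_ofReal (by positivity) h

theorem tracked_nonneg {K : ℝ} (hK : 0 < K) {a : Measure ℝ} [IsProbabilityMeasure a]
    (ha : ∀ᵐ x ∂a, |x| ≤ K) : 0 ≤ tracked K a := by
  rw [tracked_eq_toReal hK ha]; exact ENNReal.toReal_nonneg

theorem tracked_le_batta {K : ℝ} (hK : 0 < K) {a : Measure ℝ} [IsProbabilityMeasure a]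
    (ha : ∀ᵐ x ∂a, |x| ≤ K) : tracked K a ≤ batta a := by
  rw [tracked_eq_toReal hK ha, batta_eq_toReal]
  exact ENNReal.toReal_mono (lintegral_bw_ne_top ha) (lintegral_mono fun x => tw_le_bw K x)

theorem tracked_satStep_le {lam : ℕ →₀ ℝ≥0} (hlam : ∑ i ∈ lam.support, lam i = 1)
    (hmin : ∀ i ∈ lam.support, 5 ≤ i) {D : ℕ} (hD : ∀ i ∈ lam.support, i ≤ D) {dr : ℕ}
    (hdr : 1 ≤ dr) {K L : ℝ} (hK : 0 < K) (hKL : L + 3 * Real.log dr ≤ K)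
    (hKl : Real.log dr ≤ K) {c a : Measure ℝ} [IsProbabilityMeasure c] [IsProbabilityMeasure a]
    (hcL : ∀ᵐ x ∂c, |x| ≤ L) (hc : ∫⁻ x, bw x ∂c ≤ 1) (ha : ∀ᵐ x ∂a, |x| ≤ K)
    (hle : dr * batta a ≤ 1) (hDle : D * (dr * batta a) ≤ 1) :
    tracked K (satStep lam dr c K a) ≤ (dr * xi dr K a * tracked K a) ^ 2 := by
  have hprob := isProbabilityMeasure_satStep hlam dr c K a
  have hdr0 : dr ≠ 0 := by omega
  have hdr' : (1 : ℝ) ≤ dr := by exact_mod_cast hdr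
  have h0 : 0 ≤ batta a := by rw [batta_eq_toReal]; exact ENNReal.toReal_nonneg
  have hb : ∫⁻ x, bw x ∂a = ENNReal.ofReal (batta a) := by
    rw [batta_eq_toReal, ENNReal.ofReal_toReal (lintegral_bw_ne_top ha)]
  have ht : ∫⁻ x, tw K x ∂a = ENNReal.ofReal (tracked K a) := by
    rw [tracked_eq_toReal hK ha, ENNReal.ofReal_toReal
      (ne_top_of_le_ne_top (lintegral_bw_ne_top ha) (lintegral_mono fun x => tw_le_bw K x))]
  have hmul : (dr : ℝ≥0∞) * ∫⁻ x, bw x ∂a = ENNReal.ofReal (dr * batta a) := by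
    rw [ENNReal.ofReal_mul (Nat.cast_nonneg _), ENNReal.ofReal_natCast, hb]
  have hDmul : (D : ℝ≥0∞) * (dr * ∫⁻ x, bw x ∂a) = ENNReal.ofReal (D * (dr * batta a)) := by
    rw [ENNReal.ofReal_mul (Nat.cast_nonneg _), ENNReal.ofReal_natCast, hmul]
  have h := lintegral_tw_satStep_le hlam hmin hD hdr0 hK hKL hKl hcL hc ha
    (by rw [hmul]; exact ENNReal.ofReal_le_one.2 hle)
    (by rw [hDmul]; exact ENNReal.ofReal_le_one.2 hDle)
  have ht0 := tracked_nonneg hK ha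
  -- The pathwise check bound only sees the atom at `K`; `xi` also carries the nonnegative term `(dr
  -- - 1) e^K a{-K}`.
  have hxi : 1 + ((dr - 1 : ℕ) : ℝ) * a.real {K} ≤ xi dr K a := by
    rw [xi_eq hK, Nat.cast_sub hdr, Nat.cast_one]
    have : 0 ≤ ((dr : ℝ) - 1) * (Real.exp K * a.real {-K}) :=
      mul_nonneg (by linarith) (mul_nonneg (Real.exp_pos _).le measureReal_nonneg)
    linarith
  rw [tracked_eq_toReal hK (ae_abs_satStep_le hK.le)]
  have h1 := ENNReal.toReal_mono
    (by rw [ht]; finiteness) h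
  refine h1.trans ?_
  rw [ht, ENNReal.toReal_pow, ENNReal.toReal_mul, ENNReal.toReal_mul, ENNReal.toReal_natCast,
    ENNReal.toReal_ofReal ht0, ENNReal.toReal_add ENNReal.one_ne_top (by finiteness),
    ENNReal.toReal_mul, ENNReal.toReal_natCast, ENNReal.toReal_one]
  change ((dr : ℝ) * tracked K a * (1 + ((dr - 1 : ℕ) : ℝ) * a.real {K})) ^ 2 ≤ _
  have h2 : 0 ≤ 1 + ((dr - 1 : ℕ) : ℝ) * a.real {K} := by
    have := measureReal_nonneg (μ := a) (s := {K})
    positivity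
  refine pow_le_pow_left₀ (by positivity) ?_ 2
  calc (dr : ℝ) * tracked K a * (1 + ((dr - 1 : ℕ) : ℝ) * a.real {K})
      ≤ (dr : ℝ) * tracked K a * xi dr K a := by gcongr
    _ = _ := by ring

/-! ### Iteration -/

theorem satDE_succ (lam : ℕ →₀ ℝ≥0) (dr : ℕ) (c : Measure ℝ) (K : ℝ) (a : Measure ℝ) (n : ℕ) :
    satDE lam dr c K a (n + 1) = satStep lam dr c K (satDE lam dr c K a n) :=
  Function.iterate_succ_apply' _ _ _

theorem satDE_add (lam : ℕ →₀ ℝ≥0) (dr : ℕ) (c : Measure ℝ) (K : ℝ) (a : Measure ℝ) (m n : ℕ) :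
    satDE lam dr c K a (m + n) = satDE lam dr c K (satDE lam dr c K a m) n := by
  unfold satDE
  rw [add_comm, Function.iterate_add_apply]

theorem isProbabilityMeasure_satDE {lam : ℕ →₀ ℝ≥0} (hlam : ∑ i ∈ lam.support, lam i = 1)
    (dr : ℕ) (c : Measure ℝ) (K : ℝ) (a : Measure ℝ) [IsProbabilityMeasure c]
    [IsProbabilityMeasure a] (n : ℕ) : IsProbabilityMeasure (satDE lam dr c K a n) := by
  induction n with
  | zero => assumption
  | succ n ih => rw [satDE_succ]; exact isProbabilityMeasure_satStep hlam dr c K _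

theorem ae_abs_satDE_le {lam : ℕ →₀ ℝ≥0} {dr : ℕ} {c : Measure ℝ} {K : ℝ} (hK : 0 ≤ K)
    {a : Measure ℝ} (ha : ∀ᵐ x ∂a, |x| ≤ K) (n : ℕ) :
    ∀ᵐ x ∂(satDE lam dr c K a n), |x| ≤ K := by
  cases n with
  | zero => exact ha
  | succ n => rw [satDE_succ]; exact ae_abs_satStep_le hK

/-- A sequence with `x (n+1) ≤ (d * x n)^4 + ε` started in `[0, 1 / (2 d^2)]` remains there and
is geometrically attracted to `[0, 4 ε / 3]`. -/
theorem le_of_quartic_recursion {d ε : ℝ} (hd : 1 ≤ d) (hε0 : 0 ≤ ε)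
    (hε : ε ≤ 1 / (2 * d ^ 2) / 2)
    {x : ℕ → ℝ} (hx0 : ∀ n, 0 ≤ x n) (hinit : x 0 ≤ 1 / (2 * d ^ 2))
    (hrec : ∀ n, d * x n ≤ 1 → x (n + 1) ≤ (d * x n) ^ 4 + ε) (n : ℕ) :
    x n ≤ 1 / (2 * d ^ 2) ∧ x n ≤ 1 / (2 * d ^ 2) * (1 / 4) ^ n + 4 / 3 * ε := by
  -- Here `(d y)²` is at most both `y/2` and `1/2`, so the quartic term is at most `y/4`.
  have key : ∀ y, 0 ≤ y → y ≤ 1 / (2 * d ^ 2) → d * y ≤ 1 ∧ (d * y) ^ 4 ≤ y / 4 := by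
    intro y hy0 hy
    have h2 : d ^ 2 * y ≤ 1 / 2 := by
      rw [le_div_iff₀ (by positivity)] at hy
      linarith
    have h1 : d * y ≤ 1 / 2 := by
      refine le_trans ?_ h2
      gcongr
      nlinarith
    have hdy : 0 ≤ d * y := by positivity
    refine ⟨by linarith, ?_⟩
    have h3 : (d * y) ^ 2 ≤ 1 / 2 * y := by
      calc (d * y) ^ 2 = d ^ 2 * y * y := by ring
        _ ≤ 1 / 2 * y := by gcongr
    have h4 : (d * y) ^ 2 ≤ 1 / 2 := by nlinarith
    calc (d * y) ^ 4 = (d * y) ^ 2 * (d * y) ^ 2 := by ring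
      _ ≤ 1 / 2 * (1 / 2 * y) := by gcongr
      _ = y / 4 := by ring
  have hpos : ∀ n, x n ≤ 1 / (2 * d ^ 2) := by
    intro n
    induction n with
    | zero => exact hinit
    | succ n ih =>
      obtain ⟨h1, h2⟩ := key _ (hx0 n) ih
      have := hrec n h1
      have := hx0 n
      linarith
  refine ⟨hpos n, ?_⟩
  -- The constant `4/3 * ε` is the fixed point of `s ↦ s/4 + ε`.
  induction n with
  | zero =>
    rw [pow_zero, mul_one]
    linarith
  | succ n ih =>
    obtain ⟨h1, h2⟩ := key _ (hx0 n) (hpos n)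
    have := hrec n h1
    rw [pow_succ (1 / 4 : ℝ)]
    linarith

/-- Along saturated density evolution started from `a` with `𝔅(a) ≤ 1 / (2 dr²)`, the
Bhattacharyya parameter eventually drops below `2 e^{-K/2}`, uniformly in `a`. -/
theorem exists_batta_satDE_le {lam : ℕ →₀ ℝ≥0} (hlam : ∑ i ∈ lam.support, lam i = 1)
    (hmin : ∀ i ∈ lam.support, 5 ≤ i) {dr : ℕ} (hdr : 1 ≤ dr) {c : Measure ℝ}
    [IsProbabilityMeasure c] (hc : ∫⁻ x, bw x ∂c ≤ 1) {K : ℝ} (hK : 0 < K)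
    (hKx : Real.exp (-K / 2) ≤ 1 / (2 * (dr : ℝ) ^ 2) / 2) :
    ∃ N : ℕ, ∀ a : Measure ℝ, IsProbabilityMeasure a → (∀ᵐ x ∂a, |x| ≤ K) →
      batta a ≤ 1 / (2 * (dr : ℝ) ^ 2) → ∀ n, N ≤ n →
        batta (satDE lam dr c K a n) ≤ 2 * Real.exp (-K / 2) := by
  have hdr' : (1 : ℝ) ≤ dr := by exact_mod_cast hdr
  have hε := Real.exp_pos (-K / 2)
  have hx : 0 < 1 / (2 * (dr : ℝ) ^ 2) := by positivity
  -- After `N` steps the transient is below `(2/3) e^{-K/2}`, which together with the floor `(4/3)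
  -- e^{-K/2}` gives the factor `2`. The choice depends only on `K` and `dr`.
  obtain ⟨N, hN⟩ := exists_pow_lt_of_lt_one
    (show 0 < 2 / 3 * Real.exp (-K / 2) / (1 / (2 * (dr : ℝ) ^ 2)) by positivity)
    (show (1 / 4 : ℝ) < 1 by norm_num)
  refine ⟨N, fun a ha haK hax n hn => ?_⟩
  have hrec := (le_of_quartic_recursion hdr' hε.le hKx
    (x := fun n => batta (satDE lam dr c K a n))
    (fun n => by rw [batta_eq_toReal]; exact ENNReal.toReal_nonneg) hax
    (fun n hle => by
      have := isProbabilityMeasure_satDE hlam dr c K a n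
      rw [satDE_succ]
      exact batta_satStep_le hlam hmin (by omega) hc hK (ae_abs_satDE_le hK.le haK n) hle) n).2
  have hpow : (1 / 4 : ℝ) ^ n ≤ (1 / 4) ^ N :=
    pow_le_pow_of_le_one (by norm_num) (by norm_num) hn
  have := mul_lt_mul_of_pos_left (hpow.trans_lt hN) hx
  rw [mul_div_cancel₀ _ hx.ne'] at this
  linarith

/-- The rescaled sequence `M * x k` is at most squared at each step; `1 ≤ M` then removes the
scaling. -/
theorem le_pow_of_quadratic_recursion {M q : ℝ} (hM : 1 ≤ M) {x : ℕ → ℝ} (hx0 : ∀ n, 0 ≤ x n)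
    (hinit : M * x 0 ≤ q) (hrec : ∀ n, x (n + 1) ≤ M * x n ^ 2) (k : ℕ) :
    x k ≤ q ^ 2 ^ k := by
  have h : M * x k ≤ q ^ 2 ^ k := by
    induction k with
    | zero => simpa using hinit
    | succ k ih =>
      have h0 : 0 ≤ M * x k := mul_nonneg (by linarith) (hx0 k)
      calc M * x (k + 1) ≤ M * (M * x k ^ 2) := by gcongr; exact hrec k
        _ = (M * x k) ^ 2 := by ring
        _ ≤ (q ^ 2 ^ k) ^ 2 := by gcongr
        _ = q ^ 2 ^ (k + 1) := by rw [← pow_mul, ← pow_succ]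
  nlinarith [hx0 k]

theorem ae_abs_le_of_measure_Icc {a : Measure ℝ} [IsProbabilityMeasure a] {K : ℝ}
    (h : a (Icc (-K) K) = 1) : ∀ᵐ x ∂a, |x| ≤ K := by
  have := (prob_compl_eq_zero_iff (μ := a) measurableSet_Icc).2 h
  filter_upwards [measure_eq_zero_iff_ae_notMem.1 this] with x hx
  exact abs_le.2 (not_not.1 hx)

/-- While the densities of the full decoder have support in `[-M, M]`, saturating at a level
`K ≥ M` does not change density evolution. -/
theorem exists_satDE_eq_bpStep_iterate {lam : ℕ →₀ ℝ≥0} (hlam : ∑ i ∈ lam.support, lam i = 1)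
    {dr : ℕ} (hdr : dr ≠ 0) {c : Measure ℝ} [IsProbabilityMeasure c] {L : ℝ}
    (hcL : ∀ᵐ x ∂c, |x| ≤ L) (l : ℕ) :
    ∃ M : ℝ, ∀ K, M ≤ K → satDE lam dr c K (Measure.dirac 0) l =
      (bpStep lam dr c)^[l] (Measure.dirac 0) := by
  -- The induction must also carry the support bound. Taking maxima keeps `M` nondecreasing, so a
  -- level admissible at one step is admissible at all earlier ones.
  suffices h : ∃ M : ℝ, 0 ≤ M ∧ IsProbabilityMeasure ((bpStep lam dr c)^[l] (Measure.dirac 0)) ∧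
      (∀ᵐ x ∂((bpStep lam dr c)^[l] (Measure.dirac 0)), |x| ≤ M) ∧
      ∀ K, M ≤ K → satDE lam dr c K (Measure.dirac 0) l =
        (bpStep lam dr c)^[l] (Measure.dirac 0) from
    let ⟨M, _, _, _, hM⟩ := h
    ⟨M, hM⟩
  induction l with
  | zero =>
    refine ⟨0, le_rfl, ?_, ?_, fun K _ => rfl⟩
    · rw [Function.iterate_zero, id]; infer_instance
    · rw [Function.iterate_zero, id, ae_dirac_iff (measurableSet_abs_le 0), abs_zero]
  | succ l ih =>
    obtain ⟨M, hM0, hprob, hM, hsat⟩ := ih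
    rw [Function.iterate_succ_apply']
    set b := (bpStep lam dr c)^[l] (Measure.dirac 0)
    set D := lam.support.sup id
    have hsupp : ∀ᵐ x ∂(bpStep lam dr c b), |x| ≤ max M (L + D * M) := by
      refine ae_bpStep fun i hi => ?_
      filter_upwards [ae_abs_varConv_le (d := i - 1) hcL (ae_abs_checkConv_le hdr hM)] with x hx
      have hiD : ((i - 1 : ℕ) : ℝ) ≤ D := by
        exact_mod_cast (Nat.sub_le i 1).trans (Finset.le_sup (f := id) hi)
      refine (hx.trans ?_).trans (le_max_right _ _)
      gcongr
    refine ⟨max M (L + D * M), hM0.trans (le_max_left _ _),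
      isProbabilityMeasure_bpStep hlam dr c b, hsupp, fun K hK => ?_⟩
    rw [satDE_succ, hsat K ((le_max_left _ _).trans hK), satStep]
    refine (Measure.map_congr (g := id) ?_).trans Measure.map_id
    filter_upwards [hsupp] with x hx using sat_of_abs_le (hx.trans hK)

/-- The local part: density evolution of the saturated decoder from a density with small
Bhattacharyya parameter. -/
theorem exists_local_convergence {lam : ℕ →₀ ℝ≥0} (hlam : ∑ i ∈ lam.support, lam i = 1)
    (hmin : ∀ i ∈ lam.support, 5 ≤ i) {dr : ℕ} (hdr : 1 ≤ dr) {c : Measure ℝ}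
    [IsProbabilityMeasure c] (hc : ∫⁻ x, bw x ∂c ≤ 1) {L : ℝ} (hcL : ∀ᵐ x ∂c, |x| ≤ L) :
    ∃ K₀ : ℝ, 0 < K₀ ∧ ∀ K : ℝ, K₀ ≤ K → ∃ N : ℕ, ∃ q : ℝ, 0 < q ∧ q < 1 ∧
      ∀ a : Measure ℝ, IsProbabilityMeasure a → a (Icc (-K) K) = 1 →
        batta a ≤ 1 / (2 * (dr : ℝ) ^ 2) →
        (∀ n : ℕ, N ≤ n →
          tracked K (satDE lam dr c K a (n + 1)) ≤
            2 * ((dr : ℝ) * xi dr K (satDE lam dr c K a n)) ^ 2 *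
              tracked K (satDE lam dr c K a n) ^ 2 ∧
          xi dr K (satDE lam dr c K a n) ≤ 3 * (dr : ℝ)) ∧
        ∀ k : ℕ,
          perr (satDE lam dr c K a (N + k)) ≤ tracked K (satDE lam dr c K a (N + k)) ∧
          tracked K (satDE lam dr c K a (N + k)) ≤ q ^ (2 ^ k) := by
  have hdr' : (1 : ℝ) ≤ dr := by exact_mod_cast hdr
  set D := lam.support.sup id
  have hD : ∀ i ∈ lam.support, i ≤ D := fun i hi => Finset.le_sup (f := id) hi
  have hlim : Tendsto (fun K : ℝ => Real.exp (-K / 2)) atTop (nhds 0) :=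
    Real.tendsto_exp_atBot.comp (tendsto_neg_atTop_atBot.atBot_div_const two_pos)
  -- With `ε = e^{-K/2} ≤ δ`, the four entries give in turn: invariance of the quartic recursion,
  -- `dr * 2ε ≤ 1`, `D * dr * 2ε ≤ 1` (with `D + 1` keeping the denominator positive), and `9 dr^4 *
  -- 2ε ≤ 1/2`, which allows `q = 1/2`.
  set δ : ℝ := min (1 / (2 * (dr : ℝ) ^ 2) / 2)
    (min (1 / (2 * dr)) (min (1 / (2 * (D + 1) * dr)) (1 / (36 * (dr : ℝ) ^ 4))))
  have hδ : 0 < δ := by positivity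
  obtain ⟨K₁, hK₁⟩ := eventually_atTop.1 (hlim.eventually (gt_mem_nhds hδ))
  refine ⟨max 1 (max K₁ (max (L + 3 * Real.log dr) (Real.log dr))),
    lt_max_of_lt_left one_pos, fun K hK => ?_⟩
  simp only [max_le_iff] at hK
  obtain ⟨hK1, hKK, hKL, hKl⟩ := hK
  have hK0 : 0 < K := by linarith
  have hε := (hK₁ K hKK).le
  simp only [δ, le_min_iff] at hε
  obtain ⟨hε1, hε2, hε3, hε4⟩ := hε
  rw [le_div_iff₀ (by positivity)] at hε2 hε3 hε4
  have hεpos := Real.exp_pos (-K / 2)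
  set ε := Real.exp (-K / 2)
  obtain ⟨N, hN⟩ := exists_batta_satDE_le hlam hmin hdr hc hK0 hε1
  refine ⟨N, 1 / 2, by norm_num, by norm_num, fun a ha haK hax => ?_⟩
  have haK' := ae_abs_le_of_measure_Icc haK
  have hprob := isProbabilityMeasure_satDE hlam dr c K a
  have hsupp := ae_abs_satDE_le (lam := lam) (dr := dr) (c := c) hK0.le haK'
  have hbat := hN a ha haK' hax
  have ht0 : ∀ n, 0 ≤ tracked K (satDE lam dr c K a n) := fun n => tracked_nonneg hK0 (hsupp n)
  have hxi : ∀ n, N ≤ n → xi dr K (satDE lam dr c K a n) ≤ 3 * (dr : ℝ) :=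
    fun n hn => xi_le hK0 hdr (hsupp n) (hbat n hn)
  have hxi0 : ∀ n, 0 ≤ xi dr K (satDE lam dr c K a n) := fun n => by
    rw [xi_eq hK0]
    have h1 : 0 ≤ (dr : ℝ) - 1 := by linarith
    positivity
  have hstep : ∀ n, N ≤ n → tracked K (satDE lam dr c K a (n + 1)) ≤
      (dr * xi dr K (satDE lam dr c K a n) * tracked K (satDE lam dr c K a n)) ^ 2 := by
    intro n hn
    have hb := hbat n hn
    have hle : dr * batta (satDE lam dr c K a n) ≤ dr * (2 * ε) := by gcongr
    rw [satDE_succ]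
    refine tracked_satStep_le hlam hmin hD hdr hK0 hKL hKl hcL hc (hsupp n) (by linarith) ?_
    calc (D : ℝ) * (dr * batta (satDE lam dr c K a n)) ≤ D * (dr * (2 * ε)) := by gcongr
      _ ≤ (D + 1) * (dr * (2 * ε)) := by gcongr; linarith
      _ ≤ 1 := by linarith
  refine ⟨fun n hn => ⟨(hstep n hn).trans ?_, hxi n hn⟩,
    fun k => ⟨perr_le_tracked hK0 (hsupp _), ?_⟩⟩
  -- The one-step bound already holds without the factor `2`.
  · rw [mul_pow, mul_assoc]
    have : 0 ≤ (dr * xi dr K (satDE lam dr c K a n)) ^ 2 *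
      tracked K (satDE lam dr c K a n) ^ 2 := by positivity
    linarith
  · refine le_pow_of_quadratic_recursion (M := 9 * (dr : ℝ) ^ 4)
      (x := fun k => tracked K (satDE lam dr c K a (N + k))) ?_ (fun k => ht0 _) ?_ ?_ k
    · nlinarith [one_le_pow₀ hdr' (n := 4)]
    · have h1 : tracked K (satDE lam dr c K a (N + 0)) ≤ 2 * ε :=
        (tracked_le_batta hK0 (hsupp _)).trans (hbat _ (by omega))
      calc 9 * (dr : ℝ) ^ 4 * tracked K (satDE lam dr c K a (N + 0))
          ≤ 9 * (dr : ℝ) ^ 4 * (2 * ε) := by gcongr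
        _ ≤ 1 / 2 := by linarith
    · intro k
      have h1 := hstep (N + k) (by omega)
      have h2 := hxi (N + k) (by omega)
      have h3 := hxi0 (N + k)
      have h4 := ht0 (N + k)
      rw [← add_assoc]
      calc _ ≤ _ := h1
        _ ≤ (dr * (3 * dr) * tracked K (satDE lam dr c K a (N + k))) ^ 2 := by gcongr
        _ = _ := by ring

end SatBP

/-! ### The theorem: local convergence and entry into the local region. -/

theorem mainTheorem6
    (lam : ℕ →₀ ℝ≥0) (hlam : ∑ i ∈ lam.support, lam i = 1)
    (hmin : ∀ i ∈ lam.support, 5 ≤ i)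
    (dr : ℕ) (hdr : 1 ≤ dr)
    (c : Measure ℝ) [IsProbabilityMeasure c] (hsym : SatBP.IsSymmetric c)
    (L : ℝ) (hL : c (Ioo (-L) L) = 1) :
    ∃ xstar : ℝ, 0 < xstar ∧
      -- local part: any saturated density with small Bhattacharyya parameter
      (∃ K₀ : ℝ, 0 < K₀ ∧ ∀ K : ℝ, K₀ ≤ K → ∃ N : ℕ, ∃ q : ℝ, 0 < q ∧ q < 1 ∧
        ∀ a : Measure ℝ, IsProbabilityMeasure a → a (Icc (-K) K) = 1 →
          SatBP.batta a ≤ xstar →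
          (∀ n : ℕ, N ≤ n →
            SatBP.tracked K (SatBP.satDE lam dr c K a (n + 1)) ≤
              2 * ((dr : ℝ) * SatBP.xi dr K (SatBP.satDE lam dr c K a n)) ^ 2 *
                SatBP.tracked K (SatBP.satDE lam dr c K a n) ^ 2 ∧
            SatBP.xi dr K (SatBP.satDE lam dr c K a n) ≤ 3 * (dr : ℝ)) ∧
          ∀ k : ℕ,
            SatBP.perr (SatBP.satDE lam dr c K a (N + k)) ≤
              SatBP.tracked K (SatBP.satDE lam dr c K a (N + k)) ∧
            SatBP.tracked K (SatBP.satDE lam dr c K a (N + k)) ≤ q ^ (2 ^ k)) ∧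
      -- if full BP succeeds, saturated density evolution from `Δ_0` enters that region
      (SatBP.BPSuccessful lam dr c →
        ∃ K₁ : ℝ, 0 < K₁ ∧ ∀ K : ℝ, K₁ ≤ K →
          (∃ n₀ : ℕ,
            SatBP.batta (SatBP.satDE lam dr c K (Measure.dirac 0) n₀) ≤ xstar) ∧
          ∃ N : ℕ, ∃ q : ℝ, 0 < q ∧ q < 1 ∧ ∀ k : ℕ,
            SatBP.perr (SatBP.satDE lam dr c K (Measure.dirac 0) (N + k)) ≤ q ^ (2 ^ k)) := by
  have hcL : ∀ᵐ x ∂c, |x| ≤ L := SatBP.ae_abs_le_of_measure_Icc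
    (le_antisymm prob_le_one (hL ▸ measure_mono Ioo_subset_Icc_self))
  have hc := SatBP.lintegral_bw_le_one hsym
  have hx : 0 < 1 / (2 * (dr : ℝ) ^ 2) := by
    have : (1 : ℝ) ≤ dr := by exact_mod_cast hdr
    positivity
  obtain ⟨K₀, hK₀, hloc⟩ := SatBP.exists_local_convergence hlam hmin hdr hc hcL
  refine ⟨_, hx, ⟨K₀, hK₀, hloc⟩, fun hBP => ?_⟩
  obtain ⟨l, hl⟩ := hBP _ hx
  obtain ⟨M, hM⟩ := SatBP.exists_satDE_eq_bpStep_iterate (lam := lam) hlam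
    (Nat.one_le_iff_ne_zero.1 hdr) hcL l
  refine ⟨max K₀ M, lt_max_of_lt_left hK₀, fun K hK => ?_⟩
  have hK0 : 0 < K := hK₀.trans_le ((le_max_left _ _).trans hK)
  have hbat : SatBP.batta (SatBP.satDE lam dr c K (Measure.dirac 0) l) ≤
      1 / (2 * (dr : ℝ) ^ 2) := by
    rw [hM K ((le_max_right _ _).trans hK)]
    exact hl.le
  refine ⟨⟨l, hbat⟩, ?_⟩
  obtain ⟨N, q, hq0, hq1, h⟩ := hloc K ((le_max_left _ _).trans hK)
  have hprob := SatBP.isProbabilityMeasure_satDE hlam dr c K (Measure.dirac 0) l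
  have hsupp : ∀ᵐ x ∂(SatBP.satDE lam dr c K (Measure.dirac 0) l), x ∈ Icc (-K) K := by
    have h0 : ∀ᵐ x ∂(Measure.dirac (0 : ℝ)), |x| ≤ K := by
      rw [ae_dirac_iff (SatBP.measurableSet_abs_le K), abs_zero]
      exact hK0.le
    filter_upwards [SatBP.ae_abs_satDE_le (lam := lam) (dr := dr) (c := c) hK0.le h0 l] with x hx
      using abs_le.1 hx
  -- The local statement is restarted from the density at time `l`.
  refine ⟨l + N, q, hq0, hq1, fun k => ?_⟩
  obtain ⟨h1, h2⟩ := (h _ hprob ((mem_ae_iff_prob_eq_one measurableSet_Icc).1 hsupp) hbat).2 k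
  rw [add_assoc, SatBP.satDE_add]
  exact h1.trans h2
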